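/- **Setting.** Let $\mathcal M$ be an episodic MDP with horizon $H$, state space $\mathcal S$, discrete action space $\mathcal A$, initial distribution $P_0$, transitions $P_h:\mathcal S\times\mathcal A\to\Delta(\mathcal S)$ and reward distributions $\mathcal R:\mathcal S\times\mathcal A\to\Delta([0,1])$. A Markovian policy $\pi=(\pi_h)_{h=1}^H$, $\pi_h:\mathcal S\to\Delta(\mathcal A)$, induces a law $\mathbb P^\pi$ of trajectories $(s_h,a_h,r_h)_{h=1}^H$; put $J(\pi)=\mathbb E^\pi[\sum_{h=1}^H r_h]$ and $\pi(a_{1:H}\,\|\,s_{1:H})=\prod_{h=1}^H\pi_h(a_h\mid s_h)$. Assume that $\sum_{h=1}^H r_h\in[0,R]$ for all trajectories (almost surely under every Markovian policy). Let $\mathcal B$ be a finite class of $B$ Markovian policies which contains the deterministic expert policy $\pi^{\mathrm E}$ (realizability). No recoverability assumption is made. For $u\in\Delta(\mathcal B)$ let $\pi_u$ be the first-step mixing policy: draw $\pi\sim u$ at the beginning of the episode and execute $\pi$ throughout. Thus $\mathbb P^{\pi_u}=\sum_{\pi\in\mathcal B}u(\pi)\mathbb P^\pi$, and put $\pi_u(\cdot\,\|\,s_{1:H})=\sum_{\pi\in\mathcal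 B}u(\pi)\,\pi(\cdot\,\|\,s_{1:H})$. **Tragger with exponential weights.** For $n=1,\dots,N$ ($N\ge1$): choose $$u^n(\pi)=\frac{w^{n-1}_\pi}{\sum_{\pi'\in\mathcal B}w^{n-1}_{\pi'}},\qquad w^{n-1}_\pi=\exp\Big(-\sum_{i=1}^{n-1}\ell^i(e_\pi)\Big),$$ where $e_\pi$ is the point mass at $\pi$; execute $\pi^n=\pi_{u^n}$ and sample its state sequence $s^n_{1:H}\sim\mathbb P^{\pi^n}$; query the expert's trajectory-wise annotation $a^{*,n}_h=\pi^{\mathrm E}_h(s^n_h)$, $h=1,\dots,H$; and set $\ell^n(u)=\log\big(1/\pi_u(a^{*,n}_{1:H}\,\|\,s^n_{1:H})\big)\in[0,\infty]$. After $N$ rounds, that is $N$ trajectory-wise annotations, output the first-step uniform mixture $\hat\pi$ of $\pi^1,\dots,\pi^N$, that is $\hat\pi=\pi_{\hat u}$ with $\hat u=\frac1N\sum_{n=1}^N u^n$. **Theorem.** For every $\delta\in(0,1)$, with probability at least $1-\delta$ over the run of the algorithm, $$\sum_{n=1}^N\mathbb E^{\pi^n}\Big[D_{\mathrm H}^2\big(\pi^n(\cdot\,\|\,s_{1:H}),\pi^{\mathrm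 E}(\cdot\,\|\,s_{1:H})\big)\Big]\le\log B+2\log(1/\delta),$$ where $D_{\mathrm H}^2(p,q)=\sum_{a_{1:H}}\big(\sqrt{p(a_{1:H})}-\sqrt{q(a_{1:H})}\big)^2$ and the expectation in the $n$-th term is over a fresh episode of $\pi^n$ given the previous rounds; and furthermore $$J(\pi^{\mathrm E})-J(\hat\pi)\le 2R\,\frac{\log B+2\log(1/\delta)}{N}.$$ -/

import Mathlib

open MeasureTheory ProbabilityTheory
open scoped ENNReal

namespace ImitationLearning

noncomputable section

/-- An episodic Markov decision process with horizon `H`: initial distribution `P_0`, transitions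
`P_1, …, P_H` and a reward distribution on `[0, 1]` for every state-action pair.
(The last transition kernel has no influence: the state that follows step `H` is never recorded.) -/
structure EpisodicMDP (S A : Type*) [MeasurableSpace S] [MeasurableSpace A] (H : ℕ) where
  init : Measure S
  init_prob : IsProbabilityMeasure init
  trans : Fin H → Kernel (S × A) S
  trans_markov : ∀ h, IsMarkovKernel (trans h)
  reward : Kernel (S × A) unitInterval
  reward_markov : IsMarkovKernel reward

/-- A (possibly non-stationary, possibly stochastic) Markovian policy `π = (π_1, …, π_H)`. -/
structure MarkovPolicy (S A : Type*) [MeasurableSpace S] [MeasurableSpace A] (H : ℕ) where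
  act : Fin H → Kernel S A
  markov : ∀ h, IsMarkovKernel (act h)

/-- The deterministic Markovian policy that takes the action `f h s` in state `s` at step `h`. -/
def deterministicPolicy {S A : Type*} [MeasurableSpace S] [MeasurableSpace A] {H : ℕ}
    (f : Fin H → S → A) (hf : ∀ h, Measurable (f h)) : MarkovPolicy S A H where
  act h := Kernel.deterministic (f h) (hf h)
  markov _ := inferInstance

/-- Trajectories `(s_h, a_h, r_h)_{h = 1, …, H}`. -/
abbrev Trajectory (S A : Type*) (H : ℕ) := Fin H → S × A × unitInterval

/-- The law of the trajectory that starts in a given state `s`: draw `a ∼ π_1(s)`, then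
independently `r ∼ R(s, a)` and `s' ∼ P_1(s, a)`, record `(s, a, r)`, and continue from `s'`
with the remaining steps. -/
def rollout {S A : Type*} [MeasurableSpace S] [MeasurableSpace A]
    (rew : Kernel (S × A) unitInterval) :
    (H : ℕ) → (Fin H → Kernel (S × A) S) → (Fin H → Kernel S A) → Kernel S (Trajectory S A H)
  | 0, _, _ => Kernel.const S (Measure.dirac Fin.elim0)
  | H + 1, P, π =>
    ((Kernel.id ×ₖ (π 0 ⊗ₖ (rew ×ₖ P 0))) ⊗ₖ
      (rollout rew H (fun h => P h.succ) (fun h => π h.succ)).comap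
        (fun x : S × (S × (A × (unitInterval × S))) => x.2.2.2.2) (by fun_prop)).map
      (fun y : (S × (A × (unitInterval × S))) × Trajectory S A H =>
        (Fin.cons (y.1.1, y.1.2.1, y.1.2.2.1) y.2 : Trajectory S A (H + 1)))

/-- The trajectory law `ℙ^π` of a Markovian policy `π`. -/
def EpisodicMDP.trajLaw {S A : Type*} [MeasurableSpace S] [MeasurableSpace A] {H : ℕ}
    (M : EpisodicMDP S A H) (π : MarkovPolicy S A H) : Measure (Trajectory S A H) :=
  M.init.bind (rollout M.reward H M.trans π.act)

/-- Normalized return: the total reward `r_1 + ⋯ + r_H` always lies in `[0, R]`, that is, almost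
surely whatever Markovian policy is executed. -/
def EpisodicMDP.NormalizedReturn {S A : Type*} [MeasurableSpace S] [MeasurableSpace A] {H : ℕ}
    (M : EpisodicMDP S A H) (R : ℝ) : Prop :=
  ∀ π : MarkovPolicy S A H, ∀ᵐ τ ∂(M.trajLaw π), ∑ h, ((τ h).2.2 : ℝ) ∈ Set.Icc 0 R

/-- The expected return of a policy whose trajectory law is `μ`. -/
def expectedReturn {S A : Type*} [MeasurableSpace S] [MeasurableSpace A] {H : ℕ}
    (μ : Measure (Trajectory S A H)) : ℝ :=
  ∫ τ, ∑ h, ((τ h).2.2 : ℝ) ∂μ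

/-- The causally conditioned probability `π(a_{1:H} ‖ s_{1:H}) = ∏_h π_h(a_h | s_h)`. -/
def causalProb {S A : Type*} [MeasurableSpace S] [MeasurableSpace A] {H : ℕ}
    (π : MarkovPolicy S A H) (s : Fin H → S) (a : Fin H → A) : ℝ≥0∞ :=
  ∏ h, π.act h (s h) {a h}

/-- `π_u(a_{1:H} ‖ s_{1:H}) = ∑_{π ∈ B} u(π) π(a_{1:H} ‖ s_{1:H})` for the first-step mixing
policy `π_u`. -/
def mixCausalProb {S A : Type*} [MeasurableSpace S] [MeasurableSpace A] {H : ℕ}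
    (B : Finset (MarkovPolicy S A H)) (u : B → ℝ≥0∞) (s : Fin H → S) (a : Fin H → A) : ℝ≥0∞ :=
  ∑ π : B, u π * causalProb π.1 s a

/-- The trajectory law of the first-step mixing policy `π_u`: draw `π ∼ u` at the beginning of
the episode and execute `π` throughout the episode. -/
def EpisodicMDP.mixTrajLaw {S A : Type*} [MeasurableSpace S] [MeasurableSpace A] {H : ℕ}
    (M : EpisodicMDP S A H) (B : Finset (MarkovPolicy S A H)) (u : B → ℝ≥0∞) :
    Measure (Trajectory S A H) :=
  ∑ π : B, u π • M.trajLaw π.1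

/-- The law of the state sequence `s_{1:H}` under the first-step mixing policy `π_u`. -/
def EpisodicMDP.mixStateLaw {S A : Type*} [MeasurableSpace S] [MeasurableSpace A] {H : ℕ}
    (M : EpisodicMDP S A H) (B : Finset (MarkovPolicy S A H)) (u : B → ℝ≥0∞) :
    Measure (Fin H → S) :=
  (M.mixTrajLaw B u).map (fun τ h => (τ h).1)

/-- The squared Hellinger distance of two probability mass functions on a countable set. -/
def hellingerSq {X : Type*} (p q : X → ℝ≥0∞) : ℝ≥0∞ :=
  ∑' x, ENNReal.ofReal ((√(p x).toReal - √(q x).toReal) ^ 2)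

open Classical in
/-- The exponential weights algorithm with learning rate `η` on the simplex `Δ(X)`, after the
loss functions `ℓ_1, …, ℓ_n` have been revealed:
`u(x) = w_x / ∑_{x'} w_{x'}` with `w_x = exp (- η ∑_i ℓ_i(e_x))`.
Losses may be infinite, with `exp (-∞) = 0`. -/
def expWeights {X : Type*} [Fintype X] (η : ℝ) {n : ℕ} (loss : Fin n → (X → ℝ≥0∞) → EReal) :
    X → ℝ≥0∞ :=
  fun x => EReal.exp (-((η : EReal) * ∑ i, loss i (Pi.single x 1))) /
    ∑ x', EReal.exp (-((η : EReal) * ∑ i, loss i (Pi.single x' 1)))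

/-- The answer `a*_{1:H} = (f_h(s_h))_h` of the trajectory-wise annotation oracle, for the
deterministic expert `f`. -/
def annotate {S A : Type*} {H : ℕ} (f : Fin H → S → A) (s : Fin H → S) : Fin H → A :=
  fun h => f h (s h)

/-- The log loss `ℓ(u) = log (1 / π_u(a*_{1:H} ‖ s_{1:H}))` of the annotated sequence
`s_{1:H}`; its value is `∞` if the probability is zero. -/
def logLoss {S A : Type*} [MeasurableSpace S] [MeasurableSpace A] {H : ℕ}
    (B : Finset (MarkovPolicy S A H)) (f : Fin H → S → A) (s : Fin H → S) (u : B → ℝ≥0∞) :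
    EReal :=
  ENNReal.log (mixCausalProb B u s (annotate f s))⁻¹

/-- The mixing weights that Tragger chooses after having seen (and had annotated) the state
sequences `hist 0, …, hist (n - 1)`. -/
def traggerWeights {S A : Type*} [MeasurableSpace S] [MeasurableSpace A] {H : ℕ}
    (B : Finset (MarkovPolicy S A H)) (f : Fin H → S → A) {n : ℕ}
    (hist : Fin n → Fin H → S) : B → ℝ≥0∞ :=
  expWeights 1 (fun i => logLoss B f (hist i))

/-- The joint law of the state sequences `s^1_{1:H}, …, s^n_{1:H}` of the first `n` rounds of
Tragger: given the previous ones, the next state sequence is that of an episode of `π_u`, for the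
current mixing weights `u`. -/
def EpisodicMDP.traggerLaw {S A : Type*} [MeasurableSpace S] [MeasurableSpace A] {H : ℕ}
    (M : EpisodicMDP S A H) (B : Finset (MarkovPolicy S A H)) (f : Fin H → S → A) :
    (n : ℕ) → Measure (Fin n → Fin H → S)
  | 0 => Measure.dirac Fin.elim0
  | n + 1 => (M.traggerLaw B f n).bind fun hist =>
      (M.mixStateLaw B (traggerWeights B f hist)).map
        (fun s => (Fin.snoc hist s : Fin (n + 1) → Fin H → S))

/-- The mixing weights `u^n` that Tragger uses in round `n` of the run with state sequences
`run`. -/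
def roundWeights {S A : Type*} [MeasurableSpace S] [MeasurableSpace A] {H : ℕ}
    (B : Finset (MarkovPolicy S A H)) (f : Fin H → S → A) {N : ℕ}
    (run : Fin N → Fin H → S) (n : Fin N) : B → ℝ≥0∞ :=
  traggerWeights B f (fun i : Fin n => run (i.castLE n.is_lt.le))

/-- The weights of the first-step uniform mixture of `π_{u^1}, …, π_{u^N}`. -/
def uniformMixture {X : Type*} {N : ℕ} (u : Fin N → X → ℝ≥0∞) : X → ℝ≥0∞ :=
  fun x => (∑ n, u n x) / N

/-- The decoupled Hellinger estimation error
`∑_n 𝔼^{π_{u^n}} [D_H²(π_{u^n}(· ‖ s_{1:H}), πE(· ‖ s_{1:H}))]`. -/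
def EpisodicMDP.estTraj {S A : Type*} [MeasurableSpace S] [MeasurableSpace A] {H : ℕ}
    (M : EpisodicMDP S A H) (B : Finset (MarkovPolicy S A H)) (πE : MarkovPolicy S A H) {N : ℕ}
    (u : Fin N → B → ℝ≥0∞) : ℝ≥0∞ :=
  ∑ n, ∫⁻ s, hellingerSq (mixCausalProb B (u n) s) (causalProb πE s) ∂(M.mixStateLaw B (u n))

end

end ImitationLearning

open ImitationLearning

/-! Let `q(s)` be the probability that a mixture `π_u` gives to the expert's annotation of `s`. As
the expert is deterministic, the squared Hellinger distance is `2 - 2√q`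
(`hellingerSq_mixCausalProb`), and both claims become statements about `q`.

Estimation. Exponential weights with unit rate on the log loss are Bayesian posterior weights for
the uniform prior. Hence the product of the `q_n` along a run telescopes to `1/|B|` times the total
likelihood of the class, which is at least `1/|B|` because the expert's own likelihood is `1`
(`card_inv_le_prod_mixAnnotProb`). The conditional mean of `√q_n` is `1 - D_n/2 ≤ exp(-D_n/2)`, with
`D_n` the `n`-th Hellinger term. Dividing each `√q_n` by this mean gives a nonnegative process of
expectation at most `1` that dominates `exp(∑ D_n/2) / √|B|`. Markov's inequality at level `1/δ` and
a logarithm give the first bound.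

Regret. A change of measure gives `𝔼^E[F q] ≤ 𝔼^u[F]` for `F ≥ 0`, so the mixture loses at most `R
𝔼^E[1 - q]`. This expectation is under the expert's law, whereas estimation controls the learner's.
The bridge is `lintegral_sq_sub_mixAgreeProb_sq_le`, which yields `𝔼^E[1 - q] ≤ 𝔼^E[1 - q²] ≤ 2
𝔼^u[1 - q]` without recoverability. Finally `1 - q ≤ 2 - 2√q`, and the return is linear in the
mixing weights. -/

open ImitationLearning

namespace ImitationLearning

/-! ### Rollouts from a fixed state and change of measure to the expert. -/

section Rollouts

variable {S A : Type*} [MeasurableSpace S] [MeasurableSpace A] {H : ℕ}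

theorem measurable_finCons {X : Type*} [MeasurableSpace X] :
    Measurable (fun y : X × (Fin H → X) => (Fin.cons y.1 y.2 : Fin (H + 1) → X)) := by
  refine measurable_pi_lambda _ fun i => ?_
  refine Fin.cases ?_ (fun j => ?_) i
  · simpa using measurable_fst
  · simp only [Fin.cons_succ]; fun_prop

theorem measurable_finSnoc {X : Type*} [MeasurableSpace X] :
    Measurable (fun y : (Fin H → X) × X => (Fin.snoc y.1 y.2 : Fin (H + 1) → X)) := by
  refine measurable_pi_lambda _ fun i => ?_
  refine Fin.lastCases ?_ (fun j => ?_) i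
  · simpa using measurable_snd
  · simp only [Fin.snoc_castSucc]; fun_prop

theorem measurable_rolloutCons :
    Measurable (fun y : (S × (A × (unitInterval × S))) × Trajectory S A H =>
        (Fin.cons (y.1.1, y.1.2.1, y.1.2.2.1) y.2 : Trajectory S A (H + 1))) :=
  measurable_finCons.comp (f := fun y : (S × (A × (unitInterval × S))) × Trajectory S A H =>
    ((y.1.1, y.1.2.1, y.1.2.2.1), y.2)) (by fun_prop)

theorem isMarkovKernel_rollout (rew : Kernel (S × A) unitInterval) [IsMarkovKernel rew]
    (P : Fin H → Kernel (S × A) S) (π : Fin H → Kernel S A)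
    (hP : ∀ h, IsMarkovKernel (P h)) (hπ : ∀ h, IsMarkovKernel (π h)) :
    IsMarkovKernel (rollout rew H P π) := by
  induction H with
  | zero => rw [rollout]; infer_instance
  | succ H ih =>
    rw [rollout]
    have := ih (fun h => P h.succ) (fun h => π h.succ) (fun h => hP _) (fun h => hπ _)
    have := hP 0
    have := hπ 0
    exact Kernel.IsMarkovKernel.map _ measurable_rolloutCons

theorem lintegral_rollout_succ (rew : Kernel (S × A) unitInterval) [IsMarkovKernel rew]
    (P : Fin (H + 1) → Kernel (S × A) S) (π : Fin (H + 1) → Kernel S A)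
    (hP : ∀ h, IsMarkovKernel (P h)) (hπ : ∀ h, IsMarkovKernel (π h)) (s : S)
    {F : Trajectory S A (H + 1) → ℝ≥0∞} (hF : Measurable F) :
    ∫⁻ τ, F τ ∂(rollout rew (H + 1) P π s) =
      ∫⁻ a, ∫⁻ x, ∫⁻ τ, F (Fin.cons (s, a, x.1) τ)
        ∂(rollout rew H (fun h => P h.succ) (fun h => π h.succ) x.2)
        ∂((rew ×ₖ P 0) (s, a)) ∂(π 0 s) := by
  have h1 := isMarkovKernel_rollout rew (fun h => P h.succ) (fun h => π h.succ)
    (fun h => hP _) (fun h => hπ _)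
  have := hP 0
  have := hπ 0
  have hG : Measurable fun y : (S × (A × (unitInterval × S))) × Trajectory S A H =>
      F (Fin.cons (y.1.1, y.1.2.1, y.1.2.2.1) y.2) := hF.comp measurable_rolloutCons
  have hG' : Measurable fun y : S × (A × (unitInterval × S)) =>
      ∫⁻ τ, F (Fin.cons (y.1, y.2.1, y.2.2.1) τ)
        ∂(rollout rew H (fun h => P h.succ) (fun h => π h.succ) y.2.2.2) :=
    Measurable.lintegral_kernel_prod_right' (κ := (rollout rew H (fun h => P h.succ)
      (fun h => π h.succ)).comap (fun x : S × (S × (A × (unitInterval × S))) => x.2.2.2.2)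
        (by fun_prop))
      (f := fun y : (S × S × (A × (unitInterval × S))) × Trajectory S A H =>
        F (Fin.cons (y.1.2.1, y.1.2.2.1, y.1.2.2.2.1) y.2))
        (hG.comp (g := fun y : (S × (A × (unitInterval × S))) × Trajectory S A H =>
          F (Fin.cons (y.1.1, y.1.2.1, y.1.2.2.1) y.2))
          (f := fun y : (S × S × (A × (unitInterval × S))) × Trajectory S A H => (y.1.2, y.2))
          (by fun_prop)) |>.comp (measurable_prodMk_left (x := s))
  rw [rollout, Kernel.map_apply _ measurable_rolloutCons, lintegral_map hF measurable_rolloutCons,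
    Kernel.lintegral_compProd _ _ _ hG, Kernel.prod_apply, Kernel.id_apply]
  simp only [Kernel.comap_apply]
  rw [lintegral_prod _ hG'.aemeasurable, lintegral_dirac']
  · rw [Kernel.lintegral_compProd]
    exact hG'.comp measurable_prodMk_left
  · exact hG'.lintegral_prod_right'

/-- The probability that the action kernels `act` give to the actions `f` along the states `s`. -/
noncomputable def agreeProb (f : Fin H → S → A) (act : Fin H → Kernel S A) (s : Fin H → S) :
    ℝ≥0∞ :=
  ∏ h, act h (s h) {f h (s h)}

/-- The sequence of states of a trajectory. -/
def Trajectory.states (τ : Trajectory S A H) : Fin H → S := fun h => (τ h).1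

theorem measurable_states : Measurable (Trajectory.states (S := S) (A := A) (H := H)) :=
  measurable_pi_lambda _ fun h => measurable_fst.comp (measurable_pi_apply h)

theorem agreeProb_cons (f : Fin (H + 1) → S → A) (act : Fin (H + 1) → Kernel S A) (s : S)
    (a : A) (r : unitInterval) (τ : Trajectory S A H) :
    agreeProb f act (Trajectory.states (Fin.cons (s, a, r) τ : Trajectory S A (H + 1))) =
      act 0 s {f 0 s} * agreeProb (fun h => f h.succ) (fun h => act h.succ) τ.states := by
  simp [agreeProb, Fin.prod_univ_succ, Trajectory.states]

theorem sq_sub_sq_le_two_mul {V W : ℝ≥0∞} (h : W ≤ V) : V ^ 2 - W ^ 2 ≤ 2 * (V * (V - W)) := by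
  obtain ⟨d, rfl⟩ := exists_add_of_le h
  rw [tsub_le_iff_left]
  by_cases hW : W = ∞
  · simp [hW]
  rw [ENNReal.add_sub_cancel_left hW]
  calc (W + d) ^ 2 ≤ (W + d) ^ 2 + d ^ 2 := le_self_add
    _ = _ := by ring

theorem agreeProb_le_one (f : Fin H → S → A) (act : Fin H → Kernel S A)
    (hact : ∀ h, IsMarkovKernel (act h)) (s : Fin H → S) : agreeProb f act s ≤ 1 :=
  Finset.prod_le_one' fun h _ => by have := hact h; exact prob_le_one

/-- The mixture with weights `v` of the probabilities `agreeProb`. -/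
noncomputable def mixAgreeProb {ι : Type*} [Fintype ι] (f : Fin H → S → A)
    (act : ι → Fin H → Kernel S A) (v : ι → ℝ≥0∞) (s : Fin H → S) : ℝ≥0∞ :=
  ∑ i, v i * agreeProb f (act i) s

theorem mixAgreeProb_cons {ι : Type*} [Fintype ι] (f : Fin (H + 1) → S → A)
    (act : ι → Fin (H + 1) → Kernel S A) (v : ι → ℝ≥0∞) (s : S)
    (a : A) (r : unitInterval) (τ : Trajectory S A H) :
    mixAgreeProb f act v (Trajectory.states (Fin.cons (s, a, r) τ : Trajectory S A (H + 1))) =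
      mixAgreeProb (fun h => f h.succ) (fun i h => act i h.succ)
        (fun i => v i * act i 0 s {f 0 s}) τ.states := by
  simp only [mixAgreeProb, agreeProb_cons, mul_assoc]

theorem mixAgreeProb_le {ι : Type*} [Fintype ι] (f : Fin H → S → A)
    (act : ι → Fin H → Kernel S A) (hact : ∀ i h, IsMarkovKernel (act i h)) (v : ι → ℝ≥0∞)
    (s : Fin H → S) : mixAgreeProb f act v s ≤ ∑ i, v i :=
  Finset.sum_le_sum fun i _ => mul_le_of_le_one_right' (agreeProb_le_one f _ (hact i) s)

variable [MeasurableSingletonClass A]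

/-- Used to discard every branch of a random action except the expert's. -/
theorem mul_apply_singleton_le_lintegral (μ : Measure A) (g : A → ℝ≥0∞) (a : A) :
    μ {a} * g a ≤ ∫⁻ x, g x ∂μ := by
  rw [mul_comm, ← lintegral_singleton]
  exact setLIntegral_le_lintegral _ _

variable [Countable A]

theorem measurable_agreeProb {f : Fin H → S → A} (hf : ∀ h, Measurable (f h))
    (act : Fin H → Kernel S A) : Measurable (agreeProb f act) := by
  refine Finset.measurable_prod _ fun h _ => ?_
  -- Joint measurability in state and action is where countability of `A` enters.
  have : Measurable fun p : S × A => act h p.1 {p.2} :=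
    measurable_from_prod_countable_left fun a => Kernel.measurable_coe _ (measurableSet_singleton a)
  exact this.comp ((measurable_id.prodMk (hf h)).comp (measurable_pi_apply h))

/-- At each step only the branch on which `act` plays the expert's action is kept. On it both laws
share rewards and transitions, and the probabilities of these branches multiply up to `agreeProb`.
-/
theorem lintegral_mul_agreeProb_rollout_le (rew : Kernel (S × A) unitInterval)
    [IsMarkovKernel rew] (P : Fin H → Kernel (S × A) S) (act : Fin H → Kernel S A)
    (hP : ∀ h, IsMarkovKernel (P h)) (hact : ∀ h, IsMarkovKernel (act h))
    {f : Fin H → S → A} (hf : ∀ h, Measurable (f h)) (s : S)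
    {F : Trajectory S A H → ℝ≥0∞} (hF : Measurable F) :
    ∫⁻ τ, F τ * agreeProb f act τ.states
        ∂(rollout rew H P (fun h => Kernel.deterministic (f h) (hf h)) s) ≤
      ∫⁻ τ, F τ ∂(rollout rew H P act s) := by
  induction H generalizing s with
  | zero => simp [rollout, agreeProb]
  | succ H ih =>
    have hm : Measurable fun τ : Trajectory S A (H + 1) => F τ * agreeProb f act τ.states :=
      hF.mul ((measurable_agreeProb hf act).comp measurable_states)
    rw [lintegral_rollout_succ rew P _ hP (fun h => inferInstance) s hm,
      lintegral_rollout_succ rew P _ hP hact s hF, Kernel.deterministic_apply, lintegral_dirac]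
    refine le_trans ?_ (mul_apply_singleton_le_lintegral _ _ (f 0 s))
    simp only [agreeProb_cons]
    have hne : act 0 s {f 0 s} ≠ ∞ := by have := hact 0; exact measure_ne_top _ _
    rw [← lintegral_const_mul' _ _ hne]
    refine lintegral_mono fun x => ?_
    simp only [mul_left_comm _ (act 0 s {f 0 s})]
    rw [lintegral_const_mul' _ _ hne]
    refine mul_le_mul_right ?_ _
    exact ih (fun h => P h.succ) (fun h => act h.succ) (fun h => hP _) (fun h => hact _)
      (fun h => hf _) x.2
      (hF.comp (measurable_finCons.comp measurable_prodMk_left))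

theorem measurable_mixAgreeProb {ι : Type*} [Fintype ι] {f : Fin H → S → A}
    (hf : ∀ h, Measurable (f h)) (act : ι → Fin H → Kernel S A) (v : ι → ℝ≥0∞) :
    Measurable (mixAgreeProb f act v) :=
  Finset.measurable_sum _ fun i _ => (measurable_agreeProb hf (act i)).const_mul _

/-- Unnormalized weights make the induction on the horizon close: one agreeing step turns `v`, of
mass `V`, into `v'`, of mass `W ≤ V`. Both integrands split at `W`, as `(V² - W²) + (W² - q²)` and
`(V - W) + (W - q)`. The first parts compare by `V² - W² ≤ 2V(V - W)`. The second parts are the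
induction hypothesis for `v'`, since the agreeing branch of policy `i` carries exactly the weight
`v' i`. -/
theorem lintegral_sq_sub_mixAgreeProb_sq_le {ι : Type*} [Fintype ι]
    (rew : Kernel (S × A) unitInterval)
    [IsMarkovKernel rew] (P : Fin H → Kernel (S × A) S) (act : ι → Fin H → Kernel S A)
    (hP : ∀ h, IsMarkovKernel (P h)) (hact : ∀ i h, IsMarkovKernel (act i h))
    {f : Fin H → S → A} (hf : ∀ h, Measurable (f h)) (v : ι → ℝ≥0∞) (hv : ∑ i, v i ≠ ∞) (s : S) :
    ∫⁻ τ, ((∑ i, v i) ^ 2 - mixAgreeProb f act v τ.states ^ 2)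
        ∂(rollout rew H P (fun h => Kernel.deterministic (f h) (hf h)) s) ≤
      2 * ∑ i, v i * ∫⁻ τ, (∑ i, v i - mixAgreeProb f act v τ.states)
        ∂(rollout rew H P (act i) s) := by
  induction H generalizing s v with
  | zero => simp [rollout, agreeProb, mixAgreeProb]
  | succ H ih =>
    set V := ∑ i, v i with hV
    set v' : ι → ℝ≥0∞ := fun i => v i * act i 0 s {f 0 s} with hv'
    set W := ∑ i, v' i with hW
    have hWV : W ≤ V := Finset.sum_le_sum fun i _ =>
      mul_le_of_le_one_right' (by have := hact i 0; exact prob_le_one)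
    have hWt : W ≠ ∞ := ne_top_of_le_ne_top hv hWV
    have hm : Measurable fun τ : Trajectory S A (H + 1) => mixAgreeProb f act v τ.states :=
      (measurable_mixAgreeProb hf act v).comp measurable_states
    let q := fun τ : Trajectory S A H => mixAgreeProb (fun h => f h.succ)
      (fun i h => act i h.succ) v' τ.states
    have hqm : Measurable q := (measurable_mixAgreeProb (fun h => hf _) _ v').comp measurable_states
    have hqW : ∀ τ, q τ ≤ W := fun τ => mixAgreeProb_le _ _ (fun i h => hact i _) _ _
    rw [lintegral_rollout_succ rew P _ hP (fun h => inferInstance) s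
      (by fun_prop), Kernel.deterministic_apply, lintegral_dirac]
    simp only [mixAgreeProb_cons]
    change ∫⁻ x, ∫⁻ τ, (V ^ 2 - q τ ^ 2) ∂_ ∂_ ≤ _
    have key : ∀ i, v i * (V - W) + v' i * ∫⁻ x, ∫⁻ τ, (W - q τ)
        ∂(rollout rew H (fun h => P h.succ) (fun h => act i h.succ) x.2)
        ∂((rew ×ₖ P 0) (s, f 0 s)) ≤
        v i * ∫⁻ τ, (V - mixAgreeProb f act v τ.states) ∂(rollout rew (H + 1) P (act i) s) := by
      intro i
      have := isMarkovKernel_rollout rew (fun h => P h.succ) (fun h => act i h.succ)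
        (fun h => hP _) (fun h => hact i _)
      have := hP 0
      have := hact i 0
      rw [lintegral_rollout_succ rew P _ hP (hact i) s (by fun_prop), hv', mul_assoc, ← mul_add]
      gcongr
      simp only [mixAgreeProb_cons]
      change _ ≤ ∫⁻ a, ∫⁻ x, ∫⁻ τ, (V - q τ) ∂_ ∂_ ∂_
      -- `q` depends on the states only, not on the action drawn, so `V - W` is collected on every
      -- branch.
      have h1 : ∀ τ, V - q τ = (V - W) + (W - q τ) := fun τ =>
        (tsub_add_tsub_cancel hWV (hqW τ)).symm
      simp only [h1]
      simp only [lintegral_add_left measurable_const, lintegral_const, measure_univ, mul_one]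
      gcongr
      -- For the remainder `W - q` only the expert's action is kept; its probability is the factor
      -- that turns `v i` into `v' i`.
      exact mul_apply_singleton_le_lintegral (act i 0 s) _ (f 0 s)
    refine le_trans ?_ (mul_le_mul_right (Finset.sum_le_sum fun i _ => key i) 2)
    rw [Finset.sum_add_distrib, ← Finset.sum_mul, mul_add]
    have := isMarkovKernel_rollout rew (fun h => P h.succ)
      (fun h => Kernel.deterministic (f h.succ) (hf h.succ))
        (fun h => hP _) (fun h => inferInstance)
    have := hP 0
    have h2 : ∀ τ, V ^ 2 - q τ ^ 2 = (V ^ 2 - W ^ 2) + (W ^ 2 - q τ ^ 2) := fun τ =>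
        (tsub_add_tsub_cancel (by gcongr) (by gcongr; exact hqW τ)).symm
    simp only [h2]
    simp only [lintegral_add_left measurable_const, lintegral_const, measure_univ, mul_one]
    refine add_le_add (sq_sub_sq_le_two_mul hWV) ?_
    have hv't : ∀ i, v' i ≠ ∞ := fun i => ne_top_of_le_ne_top hWt
      (Finset.single_le_sum (fun _ _ => zero_le) (Finset.mem_univ i))
    simp_rw [← lintegral_const_mul' _ _ (hv't _)]
    rw [← lintegral_finsetSum _ (fun i _ => ?_), ← lintegral_const_mul _ ?_]
    · refine lintegral_mono fun x => ?_
      simp_rw [lintegral_const_mul' _ _ (hv't _)]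
      exact ih (fun h => P h.succ) (fun i h => act i h.succ) (fun h => hP _) (fun i h => hact i _)
        (fun h => hf _) v' hWt x.2
    · exact Finset.measurable_sum _ fun i _ => Measurable.lintegral_kernel (by fun_prop) |>.comp
        measurable_snd
    · exact Measurable.lintegral_kernel (by fun_prop) |>.comp measurable_snd

end Rollouts

/-! ### Laws of full episodes and the comparison of expert and learner. -/

section TrajectoryLaws

variable {S A : Type*} [MeasurableSpace S] [MeasurableSpace A] {H : ℕ} (M : EpisodicMDP S A H)

theorem EpisodicMDP.isMarkovKernel_rollout (π : MarkovPolicy S A H) :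
    IsMarkovKernel (rollout M.reward H M.trans π.act) := by
  have := M.reward_markov
  exact ImitationLearning.isMarkovKernel_rollout _ _ _ M.trans_markov π.markov

instance EpisodicMDP.isProbabilityMeasure_trajLaw (π : MarkovPolicy S A H) :
    IsProbabilityMeasure (M.trajLaw π) := by
  have := M.init_prob
  have := M.isMarkovKernel_rollout π
  rw [EpisodicMDP.trajLaw]
  infer_instance

theorem EpisodicMDP.lintegral_trajLaw (π : MarkovPolicy S A H) {F : Trajectory S A H → ℝ≥0∞}
    (hF : Measurable F) :
    ∫⁻ τ, F τ ∂(M.trajLaw π) = ∫⁻ s, ∫⁻ τ, F τ ∂(rollout M.reward H M.trans π.act s) ∂M.init :=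
  Measure.lintegral_bind (Kernel.aemeasurable _) hF.aemeasurable

theorem EpisodicMDP.lintegral_mixTrajLaw (B : Finset (MarkovPolicy S A H)) (u : B → ℝ≥0∞)
    (F : Trajectory S A H → ℝ≥0∞) :
    ∫⁻ τ, F τ ∂(M.mixTrajLaw B u) = ∑ π, u π * ∫⁻ τ, F τ ∂(M.trajLaw π.1) := by
  simp [EpisodicMDP.mixTrajLaw, lintegral_finsetSum_measure]

theorem EpisodicMDP.isProbabilityMeasure_mixTrajLaw (B : Finset (MarkovPolicy S A H))
    {u : B → ℝ≥0∞} (hu : ∑ π, u π = 1) : IsProbabilityMeasure (M.mixTrajLaw B u) := by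
  constructor
  simp [EpisodicMDP.mixTrajLaw, Measure.finsetSum_apply, hu, -Finset.univ_eq_attach]

theorem EpisodicMDP.lintegral_mixStateLaw (B : Finset (MarkovPolicy S A H)) (u : B → ℝ≥0∞)
    {F : (Fin H → S) → ℝ≥0∞} (hF : Measurable F) :
    ∫⁻ s, F s ∂(M.mixStateLaw B u) = ∫⁻ τ, F τ.states ∂(M.mixTrajLaw B u) :=
  lintegral_map hF measurable_states

theorem EpisodicMDP.isProbabilityMeasure_mixStateLaw (B : Finset (MarkovPolicy S A H))
    {u : B → ℝ≥0∞} (hu : ∑ π, u π = 1) : IsProbabilityMeasure (M.mixStateLaw B u) := by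
  have := M.isProbabilityMeasure_mixTrajLaw B hu
  exact Measure.isProbabilityMeasure_map measurable_states.aemeasurable

/-- The probability that the mixing policy with weights `u` gives to the annotation of the state
sequence `s`. -/
noncomputable def mixAnnotProb (B : Finset (MarkovPolicy S A H)) (f : Fin H → S → A) (u : B → ℝ≥0∞)
    (s : Fin H → S) : ℝ≥0∞ :=
  mixCausalProb B u s (annotate f s)

theorem mixAnnotProb_eq_mixAgreeProb (B : Finset (MarkovPolicy S A H)) (f : Fin H → S → A)
    (u : B → ℝ≥0∞) : mixAnnotProb B f u = mixAgreeProb f (fun π : B => π.1.act) u := rfl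

theorem mixAnnotProb_le_one (B : Finset (MarkovPolicy S A H)) (f : Fin H → S → A)
    {u : B → ℝ≥0∞} (hu : ∑ π, u π = 1) (s : Fin H → S) : mixAnnotProb B f u s ≤ 1 :=
  hu ▸ mixAgreeProb_le f _ (fun π => π.1.markov) u s

variable [Countable A] [MeasurableSingletonClass A] (B : Finset (MarkovPolicy S A H))
  {f : Fin H → S → A} (hf : ∀ h, Measurable (f h)) {u : B → ℝ≥0∞} (hu : ∑ π, u π = 1)

include hf in
theorem measurable_mixAnnotProb (u : B → ℝ≥0∞) : Measurable (mixAnnotProb B f u) :=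
  measurable_mixAgreeProb hf _ u

theorem EpisodicMDP.lintegral_mul_mixAnnotProb_le (u : B → ℝ≥0∞)
    {F : Trajectory S A H → ℝ≥0∞} (hF : Measurable F) :
    ∫⁻ τ, F τ * mixAnnotProb B f u τ.states ∂(M.trajLaw (deterministicPolicy f hf)) ≤
      ∫⁻ τ, F τ ∂(M.mixTrajLaw B u) := by
  have := M.reward_markov
  have hm : ∀ π : B, Measurable fun τ : Trajectory S A H =>
      F τ * agreeProb f π.1.act τ.states := fun π =>
    hF.mul ((measurable_agreeProb hf π.1.act).comp measurable_states)
  have hle := fun (π : B) s => lintegral_mul_agreeProb_rollout_le M.reward M.trans π.1.act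
    M.trans_markov π.1.markov hf s hF
  rw [M.lintegral_mixTrajLaw]
  simp only [mixAnnotProb_eq_mixAgreeProb, mixAgreeProb, Finset.mul_sum, mul_left_comm (F _)]
  rw [lintegral_finsetSum _ fun π _ => (hm π).const_mul _]
  refine Finset.sum_le_sum fun π _ => ?_
  rw [lintegral_const_mul _ (hm π), M.lintegral_trajLaw _ (hm π), M.lintegral_trajLaw _ hF]
  exact mul_le_mul_right (lintegral_mono (hle π)) _

include hu in
-- The transfer of the disagreement from the expert's law to the learner's: the rollout inequality
-- with total mass `V = 1`, integrated over the initial state.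
theorem EpisodicMDP.lintegral_one_sub_mixAnnotProb_le :
    ∫⁻ τ, (1 - mixAnnotProb B f u τ.states) ∂(M.trajLaw (deterministicPolicy f hf)) ≤
      2 * ∫⁻ s, (1 - mixAnnotProb B f u s) ∂(M.mixStateLaw B u) := by
  have := M.reward_markov
  have hq := measurable_mixAnnotProb B hf u
  have hq' : Measurable fun τ : Trajectory S A H => mixAnnotProb B f u τ.states :=
    hq.comp measurable_states
  rw [M.lintegral_mixStateLaw B u (by fun_prop), M.lintegral_mixTrajLaw]
  calc ∫⁻ τ, (1 - mixAnnotProb B f u τ.states) ∂(M.trajLaw (deterministicPolicy f hf))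
      ≤ ∫⁻ τ, (1 - mixAnnotProb B f u τ.states ^ 2)
          ∂(M.trajLaw (deterministicPolicy f hf)) := by
        gcongr with τ
        exact pow_le_of_le_one zero_le (mixAnnotProb_le_one B f hu _) two_ne_zero
    _ ≤ _ := by
        rw [M.lintegral_trajLaw _ (by fun_prop)]
        simp_rw [fun π => M.lintegral_trajLaw π
          (F := fun τ => 1 - mixAnnotProb B f u τ.states) (by fun_prop)]
        have hk : ∀ π : B, Measurable fun s => ∫⁻ τ, (1 - mixAnnotProb B f u τ.states)
            ∂(rollout M.reward H M.trans π.1.act s) := fun π =>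
          Measurable.lintegral_kernel (by fun_prop)
        simp_rw [← lintegral_const_mul _ (hk _)]
        rw [← lintegral_finsetSum _ fun π _ => (hk π).const_mul _, ← lintegral_const_mul _
          (Finset.measurable_sum _ fun π _ => (hk π).const_mul _)]
        refine lintegral_mono fun s => ?_
        have := lintegral_sq_sub_mixAgreeProb_sq_le M.reward M.trans (fun π : B => π.1.act)
          M.trans_markov (fun π => π.1.markov) hf u (hu ▸ ENNReal.one_ne_top) s
        rw [hu, one_pow] at this
        exact this

end TrajectoryLaws

/-! ### Returns, the regret of one mixture and of an average. -/

section Returns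

variable {S A : Type*} [MeasurableSpace S] [MeasurableSpace A] {H : ℕ} (M : EpisodicMDP S A H)

/-- The total reward of a trajectory. -/
def Trajectory.ret (τ : Trajectory S A H) : ℝ := ∑ h, ((τ h).2.2 : ℝ)

theorem Trajectory.ret_nonneg {S A : Type*} (τ : Trajectory S A H) : 0 ≤ τ.ret :=
  Finset.sum_nonneg fun h _ => (τ h).2.2.2.1

theorem Trajectory.ret_le {S A : Type*} (τ : Trajectory S A H) : τ.ret ≤ H := by
  refine (Finset.sum_le_sum fun h _ => (τ h).2.2.2.2).trans (by simp)

theorem Trajectory.measurable_ret : Measurable (Trajectory.ret (S := S) (A := A) (H := H)) := by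
  unfold Trajectory.ret
  fun_prop

theorem expectedReturn_eq_toReal_lintegral (μ : Measure (Trajectory S A H)) :
    expectedReturn μ = (∫⁻ τ, ENNReal.ofReal τ.ret ∂μ).toReal :=
  integral_eq_lintegral_of_nonneg_ae (.of_forall Trajectory.ret_nonneg)
    Trajectory.measurable_ret.aestronglyMeasurable

theorem lintegral_ret_ne_top (μ : Measure (Trajectory S A H)) [IsFiniteMeasure μ] :
    ∫⁻ τ, ENNReal.ofReal τ.ret ∂μ ≠ ∞ := by
  refine ne_top_of_le_ne_top ?_ (lintegral_mono fun τ => ENNReal.ofReal_le_ofReal τ.ret_le)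
  rw [lintegral_const]
  exact ENNReal.mul_ne_top ENNReal.ofReal_ne_top (measure_ne_top _ _)

theorem EpisodicMDP.NormalizedReturn.nonneg {M : EpisodicMDP S A H} {R : ℝ}
    (hR : M.NormalizedReturn R) (π : MarkovPolicy S A H) : 0 ≤ R := by
  obtain ⟨τ, hτ⟩ := (hR π).exists
  exact hτ.1.trans hτ.2

/-- The expert's return is split as `ret · q + ret · (1 - q)`. The change of measure bounds the
first part by the learner's return; in the second, `ret ≤ R` almost surely and the disagreement is
transferred to the learner's law. -/
theorem EpisodicMDP.expectedReturn_sub_mixTrajLaw_le [Countable A] [MeasurableSingletonClass A]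
    {R : ℝ} (hR : M.NormalizedReturn R) (B : Finset (MarkovPolicy S A H))
    {f : Fin H → S → A} (hf : ∀ h, Measurable (f h)) {u : B → ℝ≥0∞} (hu : ∑ π, u π = 1) :
    expectedReturn (M.trajLaw (deterministicPolicy f hf)) - expectedReturn (M.mixTrajLaw B u) ≤
      2 * R * (∫⁻ s, (1 - mixAnnotProb B f u s) ∂(M.mixStateLaw B u)).toReal := by
  have := M.isProbabilityMeasure_mixTrajLaw B hu
  have := M.isProbabilityMeasure_mixStateLaw B hu
  have hR0 := hR.nonneg (deterministicPolicy f hf)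
  have hF := (Trajectory.measurable_ret (S := S) (A := A) (H := H)).ennreal_ofReal
  have hq : Measurable fun τ : Trajectory S A H => mixAnnotProb B f u τ.states :=
    (measurable_mixAnnotProb B hf u).comp measurable_states
  have hFq : Measurable fun τ : Trajectory S A H =>
      ENNReal.ofReal τ.ret * mixAnnotProb B f u τ.states := hF.mul hq
  have hD : ∫⁻ s, (1 - mixAnnotProb B f u s) ∂(M.mixStateLaw B u) ≠ ∞ :=
    ne_top_of_le_ne_top (b := ∫⁻ _, 1 ∂(M.mixStateLaw B u)) (by simp)
      (lintegral_mono fun s => tsub_le_self)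
  have key : ∫⁻ τ, ENNReal.ofReal τ.ret ∂(M.trajLaw (deterministicPolicy f hf)) ≤
      ∫⁻ τ, ENNReal.ofReal τ.ret ∂(M.mixTrajLaw B u) +
        ENNReal.ofReal R * (2 * ∫⁻ s, (1 - mixAnnotProb B f u s) ∂(M.mixStateLaw B u)) := by
    calc _ = ∫⁻ τ, (ENNReal.ofReal τ.ret * mixAnnotProb B f u τ.states +
            ENNReal.ofReal τ.ret * (1 - mixAnnotProb B f u τ.states))
            ∂(M.trajLaw (deterministicPolicy f hf)) := by
          refine lintegral_congr fun τ => ?_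
          rw [← mul_add, add_tsub_cancel_of_le (mixAnnotProb_le_one B f hu _), mul_one]
      _ ≤ _ := by
          rw [lintegral_add_left hFq]
          refine add_le_add (M.lintegral_mul_mixAnnotProb_le B hf u hF) ?_
          refine le_trans ?_ (mul_le_mul_right
            (M.lintegral_one_sub_mixAnnotProb_le B hf hu) (ENNReal.ofReal R))
          rw [← lintegral_const_mul' _ _ ENNReal.ofReal_ne_top]
          refine lintegral_mono_ae ?_
          filter_upwards [hR (deterministicPolicy f hf)] with τ hτ
          gcongr
          exact hτ.2
  rw [expectedReturn_eq_toReal_lintegral, expectedReturn_eq_toReal_lintegral, sub_le_iff_le_add']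
  have h2 : ENNReal.ofReal R * (2 * ∫⁻ s, (1 - mixAnnotProb B f u s) ∂(M.mixStateLaw B u)) ≠ ∞ :=
    ENNReal.mul_ne_top ENNReal.ofReal_ne_top (ENNReal.mul_ne_top (by simp) hD)
  have := ENNReal.toReal_mono (ENNReal.add_ne_top.2 ⟨lintegral_ret_ne_top _, h2⟩) key
  rw [ENNReal.toReal_add (lintegral_ret_ne_top _) h2, ENNReal.toReal_mul, ENNReal.toReal_mul,
    ENNReal.toReal_ofReal hR0, ENNReal.toReal_ofNat] at this
  linarith

theorem EpisodicMDP.expectedReturn_mixTrajLaw (B : Finset (MarkovPolicy S A H))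
    {u : B → ℝ≥0∞} (hu : ∀ π, u π ≠ ∞) :
    expectedReturn (M.mixTrajLaw B u) = ∑ π, (u π).toReal * expectedReturn (M.trajLaw π.1) := by
  simp only [expectedReturn_eq_toReal_lintegral, M.lintegral_mixTrajLaw]
  rw [ENNReal.toReal_sum fun π _ => ENNReal.mul_ne_top (hu π) (lintegral_ret_ne_top _)]
  simp [ENNReal.toReal_mul]

theorem EpisodicMDP.expectedReturn_uniformMixture (B : Finset (MarkovPolicy S A H)) {N : ℕ}
    {u : Fin N → B → ℝ≥0∞} (hu : ∀ n π, u n π ≠ ∞) :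
    expectedReturn (M.mixTrajLaw B (uniformMixture u)) =
      (∑ n, expectedReturn (M.mixTrajLaw B (u n))) / N := by
  -- For `N = 0` both sides vanish, since `0 / 0 = 0` in `ℝ≥0∞` and in `ℝ`.
  rcases N.eq_zero_or_pos with rfl | hN
  · rw [M.expectedReturn_mixTrajLaw B fun π => by simp [uniformMixture]]
    simp [uniformMixture]
  have hN' : (N : ℝ≥0∞) ≠ 0 := by simp [hN.ne']
  rw [M.expectedReturn_mixTrajLaw B (u := uniformMixture u) fun π =>
    ENNReal.div_ne_top (ENNReal.sum_ne_top.2 fun n _ => hu n π) hN']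
  simp_rw [M.expectedReturn_mixTrajLaw B (hu _)]
  rw [Finset.sum_comm, Finset.sum_div]
  refine Finset.sum_congr rfl fun π _ => ?_
  rw [uniformMixture, ENNReal.toReal_div, ENNReal.toReal_sum fun n _ => hu n π, ← Finset.sum_mul,
    ENNReal.toReal_natCast]
  ring

end Returns

/-! ### Hellinger distance to a deterministic policy. -/

section Hellinger

open Classical in
-- The terms off the atom add up to `1 - p a`, and the atom contributes `(√(p a) - 1)²`.
theorem hellingerSq_single {X : Type*} {p : X → ℝ≥0∞} (hp : ∑' x, p x = 1)
    (a : X) : hellingerSq p (Pi.single a 1) = ENNReal.ofReal (2 - 2 * √(p a).toReal) := by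
  have h1 : ∀ x, p x ≤ 1 := fun x => hp ▸ ENNReal.le_tsum x
  have h2 : ∀ x, p x ≠ ∞ := fun x => ne_top_of_le_ne_top ENNReal.one_ne_top (h1 x)
  have h3 : p a + ∑' x, (if x = a then 0 else p x) = 1 := by
    rw [← hp, ENNReal.tsum_eq_add_tsum_ite (f := p) a]
  have h4 : ∑' x, (if x = a then 0 else p x) = ENNReal.ofReal (1 - (p a).toReal) := by
    rw [ENNReal.ofReal_sub _ ENNReal.toReal_nonneg, ENNReal.ofReal_toReal (h2 a),
      ENNReal.ofReal_one, ← h3, ENNReal.add_sub_cancel_left (h2 a)]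
  have h5 : (p a).toReal ≤ 1 := ENNReal.toReal_le_of_le_ofReal zero_le_one (by simpa using h1 a)
  rw [hellingerSq, ENNReal.tsum_eq_add_tsum_ite a]
  have h6 : ∀ x, (if x = a then 0 else
      ENNReal.ofReal ((√(p x).toReal - √((Pi.single a 1 : X → ℝ≥0∞) x).toReal) ^ 2)) =
      if x = a then 0 else p x := by
    intro x
    split_ifs with h
    · rfl
    · simp [h, Real.sq_sqrt, ENNReal.ofReal_toReal (h2 x)]
  rw [tsum_congr h6, h4, ← ENNReal.ofReal_add (sq_nonneg _) (by linarith)]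
  congr 1
  simp only [Pi.single_eq_same, ENNReal.toReal_one, Real.sqrt_one]
  nlinarith [Real.sq_sqrt (ENNReal.toReal_nonneg (a := p a))]

variable {S A : Type*} [MeasurableSpace S] [MeasurableSpace A] {H : ℕ} [Countable A]
  [MeasurableSingletonClass A]

/-- With the states frozen, the causal probability is the mass function of a product measure. -/
theorem tsum_causalProb (π : MarkovPolicy S A H) (s : Fin H → S) :
    ∑' a, causalProb π s a = 1 := by
  have := π.markov
  have h : ∀ a, causalProb π s a = Measure.pi (fun h => π.act h (s h)) {a} := fun a => by
    rw [Measure.pi_singleton]; rfl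
  simp_rw [h]
  rw [← measure_univ (μ := Measure.pi fun h => π.act h (s h)), ← lintegral_one,
    lintegral_countable']
  simp

theorem tsum_mixCausalProb (B : Finset (MarkovPolicy S A H)) (u : B → ℝ≥0∞)
    (hu : ∑ π, u π = 1) (s : Fin H → S) : ∑' a, mixCausalProb B u s a = 1 := by
  simp only [mixCausalProb]
  rw [Summable.tsum_finsetSum fun _ _ => ENNReal.summable]
  simp [ENNReal.tsum_mul_left, tsum_causalProb, hu, -Finset.univ_eq_attach]

open Classical in
theorem causalProb_deterministicPolicy {S A : Type*} [MeasurableSpace S] [MeasurableSpace A]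
    {H : ℕ} [MeasurableSingletonClass A] {f : Fin H → S → A}
    (hf : ∀ h, Measurable (f h)) (s : Fin H → S) :
    causalProb (deterministicPolicy f hf) s = Pi.single (annotate f s) 1 := by
  ext a
  have h : ∀ h, (deterministicPolicy f hf).act h (s h) {a h} =
      if annotate f s h = a h then 1 else 0 := fun h => by
    simp [deterministicPolicy, Kernel.deterministic_apply, annotate, Set.indicator_apply]
    congr
  simp only [causalProb, h, Finset.prod_ite_zero, Finset.prod_const_one, Finset.mem_univ,
    true_implies, Pi.single_apply, funext_iff, eq_comm]

theorem hellingerSq_mixCausalProb (B : Finset (MarkovPolicy S A H)) {f : Fin H → S → A}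
    (hf : ∀ h, Measurable (f h)) {u : B → ℝ≥0∞} (hu : ∑ π, u π = 1) (s : Fin H → S) :
    hellingerSq (mixCausalProb B u s) (causalProb (deterministicPolicy f hf) s) =
      ENNReal.ofReal (2 - 2 * √(mixAnnotProb B f u s).toReal) := by
  rw [causalProb_deterministicPolicy]
  convert hellingerSq_single (tsum_mixCausalProb B u hu s) (annotate f s) using 1
  · congr!
  · rfl

theorem one_sub_mixAnnotProb_le_hellingerSq (B : Finset (MarkovPolicy S A H)) {f : Fin H → S → A}
    (hf : ∀ h, Measurable (f h)) {u : B → ℝ≥0∞} (hu : ∑ π, u π = 1) (s : Fin H → S) :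
    1 - mixAnnotProb B f u s ≤
      hellingerSq (mixCausalProb B u s) (causalProb (deterministicPolicy f hf) s) := by
  have h1 := mixAnnotProb_le_one B f hu s
  have h2 := ne_top_of_le_ne_top ENNReal.one_ne_top h1
  rw [hellingerSq_mixCausalProb B hf hu]
  conv_lhs => rw [← ENNReal.ofReal_toReal h2, ← ENNReal.ofReal_one,
    ← ENNReal.ofReal_sub _ ENNReal.toReal_nonneg]
  refine ENNReal.ofReal_le_ofReal ?_
  -- The difference of the two sides is `(1 - √q)²`.
  nlinarith [Real.sq_sqrt (ENNReal.toReal_nonneg (a := mixAnnotProb B f u s)),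
    sq_nonneg (√(mixAnnotProb B f u s).toReal - 1)]

end Hellinger

/-! ### Exponential weights as Bayesian posterior weights. -/

section ExponentialWeights

theorem exp_neg_sum_log_inv {ι : Type*} (s : Finset ι) {x : ι → ℝ≥0∞} (hx : ∀ i, x i ≤ 1) :
    EReal.exp (-∑ i ∈ s, ENNReal.log (x i)⁻¹) = ∏ i ∈ s, x i := by
  classical
  -- Nonnegative losses never equal `⊥`, so negation distributes over the `EReal` sum; an infinite
  -- loss gives a factor `0`.
  have h0 : ∀ i, 0 ≤ ENNReal.log (x i)⁻¹ := fun i => by simpa using hx i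
  have hne : ∀ {y : EReal}, 0 ≤ y → y ≠ ⊥ := fun h => (EReal.bot_lt_zero.trans_le h).ne'
  induction s using Finset.induction_on with
  | empty => simp
  | insert a s ha ih =>
    rw [Finset.sum_insert ha, Finset.prod_insert ha,
      EReal.neg_add (.inl (hne (h0 a))) (.inr (hne (Finset.sum_nonneg fun i _ => h0 i))),
      sub_eq_add_neg, EReal.exp_add, ih, ENNReal.log_inv, neg_neg, ENNReal.exp_log]

variable {S A : Type*} [MeasurableSpace S] [MeasurableSpace A] {H : ℕ}
  (B : Finset (MarkovPolicy S A H)) (f : Fin H → S → A)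

/-- The unnormalized exponential weights: the probability that `π` gives to all annotations
received so far. -/
noncomputable def annotWeight {n : ℕ} (hist : Fin n → Fin H → S) (π : MarkovPolicy S A H) :
    ℝ≥0∞ :=
  ∏ i, agreeProb f π.act (hist i)

theorem annotWeight_le_one {n : ℕ} (hist : Fin n → Fin H → S) (π : MarkovPolicy S A H) :
    annotWeight f hist π ≤ 1 :=
  Finset.prod_le_one' fun _ _ => agreeProb_le_one f _ π.markov _

theorem annotWeight_snoc {n : ℕ} (hist : Fin n → Fin H → S) (s : Fin H → S)
    (π : MarkovPolicy S A H) :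
    annotWeight f (Fin.snoc hist s : Fin (n + 1) → Fin H → S) π =
      annotWeight f hist π * agreeProb f π.act s := by
  simp [annotWeight, Fin.prod_univ_castSucc]

theorem traggerWeights_eq {n : ℕ} (hist : Fin n → Fin H → S) (π : B) :
    traggerWeights B f hist π = annotWeight f hist π.1 / ∑ π' : B, annotWeight f hist π'.1 := by
  classical
  have h : ∀ π : B, EReal.exp (-(((1 : ℝ) : EReal) *
      ∑ i, logLoss B f (hist i) (Pi.single π 1))) = annotWeight f hist π.1 := fun π => by
    have h1 : ∀ i, logLoss B f (hist i) (Pi.single π 1) =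
        ENNReal.log (agreeProb f π.1.act (hist i))⁻¹ := fun i => by
      simp only [logLoss, mixCausalProb, Pi.single_apply, ite_mul, one_mul, zero_mul,
        Finset.sum_ite_eq', Finset.mem_univ, if_true]
      rfl
    simp only [h1, EReal.coe_one, one_mul]
    exact exp_neg_sum_log_inv _ fun i => agreeProb_le_one f _ π.1.markov _
  rw [traggerWeights, expWeights]
  convert congrArg₂ (· / ·) (h π) (Finset.sum_congr rfl fun π' _ => h π')

theorem sum_annotWeight_le {n : ℕ} (hist : Fin n → Fin H → S) :
    ∑ π : B, annotWeight f hist π.1 ≤ B.card := by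
  refine (Finset.sum_le_sum fun π _ => annotWeight_le_one f hist π.1).trans ?_
  simp

variable {f} [MeasurableSingletonClass A] (hf : ∀ h, Measurable (f h))

theorem agreeProb_deterministicPolicy (s : Fin H → S) :
    agreeProb f (deterministicPolicy f hf).act s = 1 := by
  simp [agreeProb, deterministicPolicy, Kernel.deterministic_apply]

variable {B}

include hf in
theorem measurable_annotWeight [Countable A] {n : ℕ} (π : MarkovPolicy S A H) :
    Measurable fun hist : Fin n → Fin H → S => annotWeight f hist π :=
  Finset.measurable_prod _ fun i _ => (measurable_agreeProb hf π.act).comp (measurable_pi_apply i)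

include hf in
theorem measurable_traggerWeights [Countable A] {n : ℕ} (π : B) :
    Measurable fun hist : Fin n → Fin H → S => traggerWeights B f hist π := by
  simp only [traggerWeights_eq]
  exact (measurable_annotWeight hf π.1).div
    (Finset.measurable_sum _ fun π' _ => measurable_annotWeight hf π'.1)

variable (hB : deterministicPolicy f hf ∈ B)

include hB

theorem one_le_sum_annotWeight {n : ℕ} (hist : Fin n → Fin H → S) :
    1 ≤ ∑ π : B, annotWeight f hist π.1 := by
  refine le_trans ?_ (Finset.single_le_sum (fun _ _ => zero_le)
    (Finset.mem_univ (⟨_, hB⟩ : B)))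
  simp [annotWeight, agreeProb_deterministicPolicy]

theorem sum_traggerWeights {n : ℕ} (hist : Fin n → Fin H → S) :
    ∑ π, traggerWeights B f hist π = 1 := by
  simp only [traggerWeights_eq, div_eq_mul_inv]
  rw [← Finset.sum_mul]
  exact ENNReal.mul_inv_cancel
    (zero_lt_one.trans_le (one_le_sum_annotWeight hf hB hist)).ne'
    (ne_top_of_le_ne_top (ENNReal.natCast_ne_top _) (sum_annotWeight_le B f hist))

theorem mixAnnotProb_traggerWeights_mul {n : ℕ} (hist : Fin n → Fin H → S) (s : Fin H → S) :
    mixAnnotProb B f (traggerWeights B f hist) s * ∑ π : B, annotWeight f hist π.1 =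
      ∑ π : B, annotWeight f (Fin.snoc hist s : Fin (n + 1) → Fin H → S) π.1 := by
  rw [mixAnnotProb_eq_mixAgreeProb, mixAgreeProb, Finset.sum_mul]
  refine Finset.sum_congr rfl fun π _ => ?_
  rw [traggerWeights_eq, annotWeight_snoc, mul_right_comm, ENNReal.div_mul_cancel
    (zero_lt_one.trans_le (one_le_sum_annotWeight hf hB hist)).ne'
    (ne_top_of_le_ne_top (ENNReal.natCast_ne_top _) (sum_annotWeight_le B f hist))]

end ExponentialWeights

section Supermartingale

variable {S A : Type*} [MeasurableSpace S] [MeasurableSpace A] {H : ℕ}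
  (M : EpisodicMDP S A H) (B : Finset (MarkovPolicy S A H)) (f : Fin H → S → A)

theorem roundWeights_snoc_castSucc {n : ℕ} (hist : Fin n → Fin H → S) (s : Fin H → S)
    (i : Fin n) :
    roundWeights B f (Fin.snoc hist s : Fin (n + 1) → Fin H → S) i.castSucc =
      roundWeights B f hist i := by
  unfold roundWeights
  congr 1
  funext j
  exact Fin.snoc_castSucc (α := fun _ => Fin H → S) s hist (j.castLE i.is_lt.le)

theorem roundWeights_snoc_last {n : ℕ} (hist : Fin n → Fin H → S) (s : Fin H → S) :
    roundWeights B f (Fin.snoc hist s : Fin (n + 1) → Fin H → S) (Fin.last n) =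
      traggerWeights B f hist := by
  unfold roundWeights
  congr 1
  funext j
  exact Fin.snoc_castSucc (α := fun _ => Fin H → S) s hist j

/-- The affinity `∑_π u(π) 𝔼^π[√q]` of the mixing policy with weights `u` and the expert, where `q`
is the probability that the mixing policy gives to the annotation. -/
noncomputable def EpisodicMDP.affinity (u : B → ℝ≥0∞) : ℝ≥0∞ :=
  ∫⁻ s, mixAnnotProb B f u s ^ (1 / 2 : ℝ) ∂(M.mixStateLaw B u)

/-- The normalized square root of the likelihood of the annotations, a nonnegative
supermartingale along the run of the algorithm. -/
noncomputable def EpisodicMDP.rootLikelihood {n : ℕ} (run : Fin n → Fin H → S) : ℝ≥0∞ :=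
  ∏ i, (mixAnnotProb B f (roundWeights B f run i) (run i) ^ (1 / 2 : ℝ) *
    (M.affinity B f (roundWeights B f run i))⁻¹)

theorem EpisodicMDP.rootLikelihood_snoc {n : ℕ} (hist : Fin n → Fin H → S) (s : Fin H → S) :
    M.rootLikelihood B f (Fin.snoc hist s : Fin (n + 1) → Fin H → S) =
      M.rootLikelihood B f hist *
        (mixAnnotProb B f (traggerWeights B f hist) s ^ (1 / 2 : ℝ) *
          (M.affinity B f (traggerWeights B f hist))⁻¹) := by
  simp [rootLikelihood, Fin.prod_univ_castSucc, roundWeights_snoc_castSucc,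
    roundWeights_snoc_last]

variable {B f}

theorem EpisodicMDP.measurable_mixStateLaw {X : Type*} [MeasurableSpace X] {u : X → B → ℝ≥0∞}
    (hu : ∀ π, Measurable fun x => u x π) : Measurable fun x => M.mixStateLaw B (u x) := by
  refine (Measure.measurable_map _ measurable_states).comp ?_
  refine Measure.measurable_of_measurable_coe _ fun t ht => ?_
  simp only [EpisodicMDP.mixTrajLaw, Measure.finsetSum_apply, Measure.smul_apply, smul_eq_mul]
  exact Finset.measurable_sum _ fun π _ => (hu π).mul_const _

variable [MeasurableSingletonClass A] (hf : ∀ h, Measurable (f h))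

section

variable (hB : deterministicPolicy f hf ∈ B)

include hB

theorem sum_roundWeights {n : ℕ} (run : Fin n → Fin H → S) (i : Fin n) :
    ∑ π, roundWeights B f run i π = 1 :=
  sum_traggerWeights hf hB _

theorem card_inv_le_prod_mixAnnotProb {n : ℕ} (run : Fin n → Fin H → S) :
    (B.card : ℝ≥0∞)⁻¹ ≤ ∏ i, mixAnnotProb B f (roundWeights B f run i) (run i) := by
  have hB0 : (B.card : ℝ≥0∞) ≠ 0 := by
    simpa using Finset.ne_empty_of_mem hB
  suffices h : ∀ (n : ℕ) (run : Fin n → Fin H → S),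
      (∏ i, mixAnnotProb B f (roundWeights B f run i) (run i)) * B.card =
        ∑ π : B, annotWeight f run π.1 by
    rw [← one_div, ENNReal.div_le_iff hB0 (ENNReal.natCast_ne_top _), h]
    exact one_le_sum_annotWeight hf hB run
  intro n
  induction n with
  | zero => intro run; simp [annotWeight]
  | succ n ih =>
    intro run
    rw [← Fin.snoc_init_self (α := fun _ => Fin H → S) run]
    generalize run (Fin.last n) = s
    generalize (Fin.init run : Fin n → Fin H → S) = hist
    rw [← mixAnnotProb_traggerWeights_mul hf hB, ← ih hist, Fin.prod_univ_castSucc]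
    simp only [roundWeights_snoc_castSucc, roundWeights_snoc_last, Fin.snoc_castSucc,
      Fin.snoc_last]
    ring

end

variable [Countable A]

include hf in
theorem measurable_mixAnnotProb_uncurry {X : Type*} [MeasurableSpace X] {u : X → B → ℝ≥0∞}
    (hu : ∀ π, Measurable fun x => u x π) {s : X → Fin H → S} (hs : Measurable s) :
    Measurable fun x => mixAnnotProb B f (u x) (s x) :=
  Finset.measurable_sum _ fun π _ => (hu π).mul ((measurable_agreeProb hf π.1.act).comp hs)

include hf in
theorem EpisodicMDP.measurable_affinity {X : Type*} [MeasurableSpace X] {u : X → B → ℝ≥0∞}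
    (hu : ∀ π, Measurable fun x => u x π) : Measurable fun x => M.affinity B f (u x) := by
  have h : ∀ u : B → ℝ≥0∞, Measurable fun s => mixAnnotProb B f u s ^ (1 / 2 : ℝ) := fun u =>
    (measurable_mixAnnotProb B hf u).pow_const _
  simp only [EpisodicMDP.affinity, M.lintegral_mixStateLaw B _ (h _), M.lintegral_mixTrajLaw]
  refine Finset.measurable_sum _ fun π _ => (hu π).mul ?_
  refine Measurable.lintegral_prod_right' (ν := M.trajLaw π.1)
    (f := fun y : X × Trajectory S A H => mixAnnotProb B f (u y.1) y.2.states ^ (1 / 2 : ℝ)) ?_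
  exact (measurable_mixAnnotProb_uncurry hf (fun π => (hu π).comp measurable_fst)
    (measurable_states.comp measurable_snd)).pow_const _

include hf in
theorem measurable_roundWeights {n : ℕ} (i : Fin n) (π : B) :
    Measurable fun run : Fin n → Fin H → S => roundWeights B f run i π :=
  (measurable_traggerWeights hf π).comp (by fun_prop :
    Measurable fun run : Fin n → Fin H → S => fun j : Fin i => run (j.castLE i.is_lt.le))

include hf in
theorem EpisodicMDP.measurable_rootLikelihood {n : ℕ} :
    Measurable (M.rootLikelihood B f (n := n)) :=
  Finset.measurable_prod _ fun i _ =>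
    ((measurable_mixAnnotProb_uncurry hf (measurable_roundWeights hf i)
      (measurable_pi_apply i)).pow_const _).mul
      (M.measurable_affinity hf (measurable_roundWeights hf i)).inv

theorem EpisodicMDP.lintegral_hellingerSq_add_two_mul_affinity {u : B → ℝ≥0∞}
    (hu : ∑ π, u π = 1) :
    ∫⁻ s, hellingerSq (mixCausalProb B u s) (causalProb (deterministicPolicy f hf) s)
      ∂(M.mixStateLaw B u) + 2 * M.affinity B f u = 2 := by
  have := M.isProbabilityMeasure_mixStateLaw B hu
  have hm : Measurable fun s => mixAnnotProb B f u s ^ (1 / 2 : ℝ) :=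
    (measurable_mixAnnotProb B hf _).pow_const _
  rw [affinity, ← lintegral_const_mul _ hm, ← lintegral_add_right _ (hm.const_mul _)]
  have h : ∀ s, hellingerSq (mixCausalProb B u s) (causalProb (deterministicPolicy f hf) s) +
      2 * mixAnnotProb B f u s ^ (1 / 2 : ℝ) = 2 := fun s => by
    have h1 := mixAnnotProb_le_one B f hu s
    have h2 := ne_top_of_le_ne_top ENNReal.one_ne_top h1
    have h3 : √(mixAnnotProb B f u s).toReal ≤ 1 := by
      rw [← Real.sqrt_one]
      refine Real.sqrt_le_sqrt ?_
      exact ENNReal.toReal_le_of_le_ofReal zero_le_one (by simpa using h1)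
    have h4 : mixAnnotProb B f u s ^ (1 / 2 : ℝ) =
        ENNReal.ofReal √(mixAnnotProb B f u s).toReal := by
      rw [Real.sqrt_eq_rpow, ← ENNReal.ofReal_rpow_of_nonneg ENNReal.toReal_nonneg (by norm_num),
        ENNReal.ofReal_toReal h2]
    rw [hellingerSq_mixCausalProb B hf hu, h4, ← ENNReal.ofReal_ofNat 2,
      ← ENNReal.ofReal_mul zero_le_two,
      ← ENNReal.ofReal_add (by linarith) (by positivity), sub_add_cancel]
  rw [lintegral_congr h]
  simp

theorem EpisodicMDP.ofReal_exp_le_inv_affinity {u : B → ℝ≥0∞} (hu : ∑ π, u π = 1) :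
    ENNReal.ofReal (Real.exp ((∫⁻ s, hellingerSq (mixCausalProb B u s)
      (causalProb (deterministicPolicy f hf) s) ∂(M.mixStateLaw B u)).toReal / 2)) ≤
      (M.affinity B f u)⁻¹ := by
  have h := M.lintegral_hellingerSq_add_two_mul_affinity hf hu
  set G := ∫⁻ s, hellingerSq (mixCausalProb B u s)
      (causalProb (deterministicPolicy f hf) s) ∂(M.mixStateLaw B u)
  have hG : G ≠ ∞ := ne_top_of_le_ne_top ENNReal.ofNat_ne_top (h ▸ le_self_add)
  have ha : 2 * M.affinity B f u ≠ ∞ := ne_top_of_le_ne_top ENNReal.ofNat_ne_top (h ▸ le_add_self)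
  have ha' : M.affinity B f u ≠ ∞ := fun h' => ha (by simp [h'])
  have h2 := congrArg ENNReal.toReal h
  rw [ENNReal.toReal_add hG ha, ENNReal.toReal_mul, ENNReal.toReal_ofNat] at h2
  rw [ENNReal.le_inv_iff_le_inv, ← ENNReal.ofReal_inv_of_pos (Real.exp_pos _), ← Real.exp_neg,
    ← ENNReal.ofReal_toReal ha']
  refine ENNReal.ofReal_le_ofReal ?_
  linarith [Real.add_one_le_exp (-(G.toReal / 2))]

variable (hB : deterministicPolicy f hf ∈ B)

include hB

theorem EpisodicMDP.measurable_traggerStep (n : ℕ) :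
    Measurable fun hist : Fin n → Fin H → S => (M.mixStateLaw B (traggerWeights B f hist)).map
        (fun s => (Fin.snoc hist s : Fin (n + 1) → Fin H → S)) := by
  let κ : Kernel (Fin n → Fin H → S) (Fin H → S) :=
    ⟨fun hist => M.mixStateLaw B (traggerWeights B f hist),
      M.measurable_mixStateLaw (measurable_traggerWeights hf)⟩
  have : IsMarkovKernel κ :=
    ⟨fun hist => M.isProbabilityMeasure_mixStateLaw B (sum_traggerWeights hf hB hist)⟩
  refine Measure.measurable_of_measurable_coe _ fun t ht => ?_
  have h := Kernel.measurable_kernel_prodMk_left (κ := κ) (measurable_finSnoc ht)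
  convert h using 2 with hist
  exact Measure.map_apply (measurable_finSnoc.comp measurable_prodMk_left) ht

theorem EpisodicMDP.lintegral_traggerLaw_succ (n : ℕ)
    {F : (Fin (n + 1) → Fin H → S) → ℝ≥0∞} (hF : Measurable F) :
    ∫⁻ run, F run ∂(M.traggerLaw B f (n + 1)) =
      ∫⁻ hist, ∫⁻ s, F (Fin.snoc hist s) ∂(M.mixStateLaw B (traggerWeights B f hist))
        ∂(M.traggerLaw B f n) := by
  rw [traggerLaw, Measure.lintegral_bind (M.measurable_traggerStep hf hB n).aemeasurable
    hF.aemeasurable]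
  exact lintegral_congr fun hist =>
    lintegral_map hF (measurable_finSnoc.comp measurable_prodMk_left)

theorem EpisodicMDP.isProbabilityMeasure_traggerLaw (n : ℕ) :
    IsProbabilityMeasure (M.traggerLaw B f n) := by
  induction n with
  | zero => rw [traggerLaw]; infer_instance
  | succ n ih =>
    refine ⟨?_⟩
    have h (hist : Fin n → Fin H → S) :=
      M.isProbabilityMeasure_mixStateLaw B (sum_traggerWeights hf hB hist)
    rw [← lintegral_one, M.lintegral_traggerLaw_succ hf hB n measurable_const]
    simp

theorem EpisodicMDP.lintegral_rootLikelihood_le_one (n : ℕ) :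
    ∫⁻ run, M.rootLikelihood B f run ∂(M.traggerLaw B f n) ≤ 1 := by
  induction n with
  | zero => simp [traggerLaw, rootLikelihood]
  | succ n ih =>
    rw [M.lintegral_traggerLaw_succ hf hB n (M.measurable_rootLikelihood hf)]
    refine (lintegral_mono fun hist => ?_).trans ih
    have hm : Measurable fun s =>
        mixAnnotProb B f (traggerWeights B f hist) s ^ (1 / 2 : ℝ) :=
      (measurable_mixAnnotProb B hf _).pow_const _
    simp only [rootLikelihood_snoc]
    rw [lintegral_const_mul _ (hm.mul_const _), lintegral_mul_const _ hm]
    exact mul_le_of_le_one_right' (ENNReal.mul_inv_le_one _)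

theorem EpisodicMDP.estTraj_ne_top {n : ℕ} (run : Fin n → Fin H → S) :
    M.estTraj B (deterministicPolicy f hf) (roundWeights B f run) ≠ ∞ :=
  ENNReal.sum_ne_top.2 fun i _ => ne_top_of_le_ne_top ENNReal.ofNat_ne_top
    (M.lintegral_hellingerSq_add_two_mul_affinity hf (sum_roundWeights hf hB run i) ▸ le_self_add)

theorem EpisodicMDP.exp_estTraj_le_rootLikelihood {n : ℕ} (run : Fin n → Fin H → S) :
    ENNReal.ofReal (Real.exp ((M.estTraj B (deterministicPolicy f hf)
      (roundWeights B f run)).toReal / 2)) * (B.card : ℝ≥0∞)⁻¹ ^ (1 / 2 : ℝ) ≤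
      M.rootLikelihood B f run := by
  have h := M.estTraj_ne_top hf hB run
  rw [rootLikelihood, Finset.prod_mul_distrib, mul_comm,
    ENNReal.prod_rpow_of_nonneg (by norm_num)]
  refine mul_le_mul' (ENNReal.rpow_le_rpow (card_inv_le_prod_mixAnnotProb hf hB run)
    (by norm_num)) ?_
  rw [estTraj, ENNReal.toReal_sum (ENNReal.sum_ne_top.1 h), Finset.sum_div, Real.exp_sum,
    ENNReal.ofReal_prod_of_nonneg fun _ _ => (Real.exp_pos _).le]
  exact Finset.prod_le_prod' fun i _ =>
    M.ofReal_exp_le_inv_affinity hf (sum_roundWeights hf hB run i)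

theorem EpisodicMDP.estTraj_le_of_rootLikelihood_le {n : ℕ} (run : Fin n → Fin H → S)
    {δ : ℝ} (hδ : 0 < δ) (h : M.rootLikelihood B f run ≤ ENNReal.ofReal (1 / δ)) :
    (M.estTraj B (deterministicPolicy f hf) (roundWeights B f run)).toReal ≤
      Real.log B.card + 2 * Real.log (1 / δ) := by
  have hB0 : 0 < (B.card : ℝ) := by exact_mod_cast Finset.card_pos.2 ⟨_, hB⟩
  have h1 := (M.exp_estTraj_le_rootLikelihood hf hB run).trans h
  set G := (M.estTraj B (deterministicPolicy f hf) (roundWeights B f run)).toReal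
  rw [← ENNReal.ofReal_natCast, ← ENNReal.ofReal_inv_of_pos hB0,
    ENNReal.ofReal_rpow_of_pos (inv_pos.2 hB0), ← ENNReal.ofReal_mul (Real.exp_pos _).le,
    ENNReal.ofReal_le_ofReal_iff (by positivity)] at h1
  have h2 := Real.log_le_log (by positivity) h1
  rw [Real.log_mul (by positivity) (by positivity), Real.log_exp, Real.log_rpow (inv_pos.2 hB0),
    Real.log_inv] at h2
  linarith

theorem EpisodicMDP.one_sub_le_traggerLaw_rootLikelihood_le (n : ℕ) {δ : ℝ} (hδ : 0 < δ) :
    ENNReal.ofReal (1 - δ) ≤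
      M.traggerLaw B f n {run | M.rootLikelihood B f run ≤ ENNReal.ofReal (1 / δ)} := by
  have := M.isProbabilityMeasure_traggerLaw hf hB n
  have hm : MeasurableSet {run : Fin n → Fin H → S |
      M.rootLikelihood B f run ≤ ENNReal.ofReal (1 / δ)} :=
    measurableSet_le (M.measurable_rootLikelihood hf) measurable_const
  rw [ENNReal.ofReal_sub _ hδ.le, ENNReal.ofReal_one, tsub_le_iff_right,
    ← prob_add_prob_compl (μ := M.traggerLaw B f n) hm]
  refine add_le_add le_rfl ?_
  calc M.traggerLaw B f n {run | M.rootLikelihood B f run ≤ ENNReal.ofReal (1 / δ)}ᶜ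
      ≤ M.traggerLaw B f n {run | ENNReal.ofReal (1 / δ) ≤ M.rootLikelihood B f run} :=
        measure_mono fun run hrun => (not_le.1 (Set.notMem_ofPred_iff.1 hrun)).le
    _ ≤ (∫⁻ run, M.rootLikelihood B f run ∂(M.traggerLaw B f n)) / ENNReal.ofReal (1 / δ) :=
        meas_ge_le_lintegral_div (M.measurable_rootLikelihood hf).aemeasurable
          (by simpa using hδ) ENNReal.ofReal_ne_top
    _ ≤ 1 / ENNReal.ofReal (1 / δ) :=
        ENNReal.div_le_div_right (M.lintegral_rootLikelihood_le_one hf hB n) _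
    _ = ENNReal.ofReal δ := by
        rw [one_div, one_div, ENNReal.ofReal_inv_of_pos hδ, inv_inv]

theorem EpisodicMDP.expectedReturn_sub_uniformMixture_le {R : ℝ} (hR : M.NormalizedReturn R)
    {n : ℕ} (hn : 0 < n) (run : Fin n → Fin H → S) :
    expectedReturn (M.trajLaw (deterministicPolicy f hf)) -
        expectedReturn (M.mixTrajLaw B (uniformMixture (roundWeights B f run))) ≤
      2 * R * ((M.estTraj B (deterministicPolicy f hf) (roundWeights B f run)).toReal / n) := by
  have hR0 := hR.nonneg (deterministicPolicy f hf)
  have hu := sum_roundWeights hf hB run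
  have hn' : (0 : ℝ) < n := by exact_mod_cast hn
  have hG := ENNReal.sum_ne_top.1 (M.estTraj_ne_top hf hB run)
  rw [M.expectedReturn_uniformMixture B fun i π => ENNReal.sum_ne_top.1
    (hu i ▸ ENNReal.one_ne_top) π (Finset.mem_univ π), estTraj, ENNReal.toReal_sum hG,
    ← mul_div_assoc, le_div_iff₀ hn', sub_mul, div_mul_cancel₀ _ hn'.ne', mul_comm _ (n : ℝ),
    Finset.mul_sum]
  have h : ∀ c : ℝ, (n : ℝ) * c = ∑ _i : Fin n, c := by simp
  rw [h, ← Finset.sum_sub_distrib]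
  refine Finset.sum_le_sum fun i _ => (M.expectedReturn_sub_mixTrajLaw_le hR B hf (hu i)).trans ?_
  refine mul_le_mul_of_nonneg_left (ENNReal.toReal_mono (hG i (Finset.mem_univ i)) ?_)
    (by positivity)
  exact lintegral_mono fun s => one_sub_mixAnnotProb_le_hellingerSq B hf (hu i) s

end Supermartingale

end ImitationLearning

theorem mainTheorem4 {S A : Type*} [MeasurableSpace S] [MeasurableSpace A]
    [Countable A] [MeasurableSingletonClass A] {H : ℕ}
    (M : EpisodicMDP S A H) (R : ℝ) (hR : M.NormalizedReturn R)
    (f : Fin H → S → A) (hf : ∀ h, Measurable (f h))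
    (B : Finset (MarkovPolicy S A H)) (hB : deterministicPolicy f hf ∈ B)
    (N : ℕ) (hN : 0 < N) (δ : ℝ) (hδ : δ ∈ Set.Ioo (0 : ℝ) 1) :
    ENNReal.ofReal (1 - δ) ≤ M.traggerLaw B f N
      {run |
        M.estTraj B (deterministicPolicy f hf) (roundWeights B f run) ≤
          ENNReal.ofReal (Real.log B.card + 2 * Real.log (1 / δ)) ∧
        expectedReturn (M.trajLaw (deterministicPolicy f hf)) -
            expectedReturn (M.mixTrajLaw B (uniformMixture (roundWeights B f run))) ≤
          2 * R * ((Real.log B.card + 2 * Real.log (1 / δ)) / N)} := by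
  have hR0 := hR.nonneg (deterministicPolicy f hf)
  refine (M.one_sub_le_traggerLaw_rootLikelihood_le hf hB N hδ.1).trans
    (measure_mono fun run hrun => ?_)
  have h := M.estTraj_le_of_rootLikelihood_le hf hB run hδ.1 hrun
  refine ⟨?_, (M.expectedReturn_sub_uniformMixture_le hf hB hR hN run).trans (by gcongr)⟩
  rw [← ENNReal.ofReal_toReal (M.estTraj_ne_top hf hB run)]
  exact ENNReal.ofReal_le_ofReal h
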